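/- **Setting.** An *orbifold chart* on a space $O$ is a triple $(\tilde U,\Gamma_U,\phi_U)$ with $\tilde U\subseteq\mathbb R^n$ open and connected, $\Gamma_U$ a finite group acting smoothly and effectively on $\tilde U$, and $\phi_U:\tilde U\to O$ a continuous $\Gamma_U$-invariant map that induces a homeomorphism from $\tilde U/\Gamma_U$ onto an open set $U\subseteq O$. An embedding of charts is a smooth embedding $\lambda:\tilde U\to\tilde V$ with $\phi_V\circ\lambda=\phi_U$; two charts are locally compatible if every point of $U\cap V$ lies in the image $W\subseteq U\cap V$ of a chart that embeds into both. An (effective, smooth, $n$-dimensional) *orbifold* $\mathcal O$ is a paracompact Hausdorff space $O$ with a maximal atlas of pairwise locally compatible orbifold charts covering $O$. For $x\in O$ with lift $\tilde x\in\tilde U$ in a chart of the atlas, let $\Gamma_x\subseteq\Gamma_U$ be the stabilizer of $\tilde x$. The singular dimension $\operatorname{sdim}(x)$ is the dimension of the subspace of $T_{\tilde x}\tilde U$ fixed by the differentials of the elements of $\Gamma_x$ (it does not depend on the chart and the lift), and $\Sigma(x)$ is the connected component containing $x$ of $\{y\in O:\operatorname{sdim}(y)=\operatorname{sdim}(x)\}$.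 A *smooth orbifold map* is a continuous map of the underlying spaces that, around each point, lifts to a smooth map between charts of the atlases; an *orbifold diffeomorphism* is a smooth orbifold map with a smooth inverse. The orbifold $\mathcal O\times[0,1]$ has the product charts $\tilde U\times J$, with $J\subseteq[0,1]$ relatively open and connected and $\Gamma_U$ acting on the first factor. An *isotopy* from $f$ to $g$ is a smooth orbifold map $F:\mathcal O\times[0,1]\to\mathcal O$ with $F(\cdot,0)=f$ and $F(\cdot,1)=g$ such that every $F(\cdot,t)$ is an orbifold diffeomorphism. The support of $f:O\to O$ is $\overline{\{z: f(z)\ne z\}}$ and the support of $F$ is $\overline{\{z: F(z,t)\neq z\text{ for some }t\}}$. $\mathrm{Diff}_{\mathrm c}(\mathcal O)$ is the group of compactly supported orbifold diffeomorphisms of $\mathcal O$ for which there is a compactly supported isotopy from the identity. **Proposition.** Let $\mathcal O$ be an orbifold, and let $U$ be an open neighborhood of a point $x\in O$. Then there exists an open subset $V$ of $\Sigma(x)$ (in the subspace topology), such that $x\in V$, $V\subseteq U$, and for each $y\in V$ there exists $f\in\mathrm{Diff}_{\mathrm c}(\mathcal O)$ such that $f(x)=y$ and there is an isotopy from the identity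 to $f$ with compact support contained in $U$. -/

import Mathlib

open Set Topology
open scoped Manifold ContDiff

/-- A smooth orbifold chart `(Ũ, Γ, φ)` of dimension `n` on `X`: an open connected
(in particular nonempty) `Ũ ⊆ ℝⁿ`, a finite group `Γ` acting smoothly and effectively on `Ũ`, and a
`Γ`-invariant continuous map `φ : Ũ → X` inducing a homeomorphism of `Ũ / Γ` onto an open subset
of `X`. -/
structure OrbifoldChart (n : ℕ) (X : Type*) [TopologicalSpace X] where
  /-- the open set `Ũ` -/
  domain : TopologicalSpace.Opens (EuclideanSpace ℝ (Fin n))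
  isConnected_domain : IsConnected (domain : Set (EuclideanSpace ℝ (Fin n)))
  /-- the group `Γ` -/
  Γ : Type
  [group : Group Γ]
  [finite : Finite Γ]
  [action : MulAction Γ domain]
  [effective : FaithfulSMul Γ domain]
  smooth_smul : ∀ γ : Γ, ContMDiff 𝓘(ℝ, EuclideanSpace ℝ (Fin n))
    𝓘(ℝ, EuclideanSpace ℝ (Fin n)) ∞ (fun p : domain => γ • p)
  /-- the map `φ` -/
  proj : domain → X
  continuous_proj : Continuous proj
  proj_smul : ∀ (γ : Γ) (p : domain), proj (γ • p) = proj p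
  isOpenEmbedding_quotient : IsOpenEmbedding
    (Quotient.lift proj (by
      rintro p q ⟨γ, rfl⟩
      exact proj_smul γ q) : Quotient (MulAction.orbitRel Γ domain) → X)

attribute [instance] OrbifoldChart.group OrbifoldChart.finite OrbifoldChart.action
  OrbifoldChart.effective

namespace OrbifoldChart

variable {n : ℕ} {X : Type*} [TopologicalSpace X]

/-- The open subset `U = φ(Ũ)` of `X` that is covered by the chart. -/
def image (c : OrbifoldChart n X) : Set X := range c.proj

/-- `l : Ũ → Ṽ` is an embedding of orbifold charts: a smooth embedding (a smooth immersion that is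
a homeomorphism onto its image) with `φ_V ∘ l = φ_U`. -/
structure IsEmbedding (c d : OrbifoldChart n X) (l : c.domain → d.domain) : Prop where
  smooth : ContMDiff 𝓘(ℝ, EuclideanSpace ℝ (Fin n)) 𝓘(ℝ, EuclideanSpace ℝ (Fin n)) ∞ l
  injective_mfderiv : ∀ p : c.domain, Function.Injective
    (mfderiv 𝓘(ℝ, EuclideanSpace ℝ (Fin n)) 𝓘(ℝ, EuclideanSpace ℝ (Fin n)) l p)
  isEmbedding : Topology.IsEmbedding l
  proj_comp : d.proj ∘ l = c.proj

/-- `c` embeds into `d`. -/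
def Embeds (c d : OrbifoldChart n X) : Prop := ∃ l : c.domain → d.domain, IsEmbedding c d l

/-- Local compatibility of two orbifold charts (no condition if their images are disjoint). -/
def LocallyCompatible (c d : OrbifoldChart n X) : Prop :=
  ∀ p ∈ c.image ∩ d.image, ∃ w : OrbifoldChart n X,
    p ∈ w.image ∧ w.image ⊆ c.image ∩ d.image ∧ w.Embeds c ∧ w.Embeds d

/-- The differential at `p` of the action of `γ`. If `γ` fixes `p`, this is the action of `γ`
on the tangent space `T_p Ũ = ℝⁿ`. -/
noncomputable def tangentAction (c : OrbifoldChart n X) (p : c.domain) (γ : c.Γ) :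
    EuclideanSpace ℝ (Fin n) →L[ℝ] EuclideanSpace ℝ (Fin n) :=
  mfderiv 𝓘(ℝ, EuclideanSpace ℝ (Fin n)) 𝓘(ℝ, EuclideanSpace ℝ (Fin n))
    (fun q : c.domain => γ • q) p

/-- The subspace `(T_p Ũ)^{Γ_p}` of vectors that are fixed by the isotropy group
`Γ_p = {γ | γ • p = p}`. -/
def fixedTangent (c : OrbifoldChart n X) (p : c.domain) :
    Submodule ℝ (EuclideanSpace ℝ (Fin n)) where
  carrier := {v | ∀ γ ∈ MulAction.stabilizer c.Γ p, c.tangentAction p γ v = v}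
  add_mem' := fun {v w} hv hw γ hγ => by rw [map_add, hv γ hγ, hw γ hγ]
  zero_mem' := fun γ _ => map_zero _
  smul_mem' := fun a v hv γ hγ => by rw [map_smul, hv γ hγ]

end OrbifoldChart

/-- An effective smooth `n`-dimensional orbifold structure on `X`: the space is paracompact and
Hausdorff, and carries a maximal orbifold atlas. -/
structure Orbifold (n : ℕ) (X : Type*) [TopologicalSpace X] where
  t2Space : T2Space X
  paracompactSpace : ParacompactSpace X
  atlas : Set (OrbifoldChart n X)
  covers : ∀ x : X, ∃ c ∈ atlas, x ∈ c.image
  compatible : ∀ c ∈ atlas, ∀ d ∈ atlas, c.LocallyCompatible d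
  maximal : ∀ c : OrbifoldChart n X, (∀ d ∈ atlas, c.LocallyCompatible d) → c ∈ atlas

namespace Orbifold

variable {m n : ℕ} {X Y : Type*} [TopologicalSpace X] [TopologicalSpace Y]

/-- Every point has a lift `x̃` to some chart of the atlas. -/
theorem exists_lift (O : Orbifold n X) (x : X) :
    ∃ q : (c : OrbifoldChart n X) × c.domain, q.1 ∈ O.atlas ∧ q.1.proj q.2 = x := by
  obtain ⟨c, hc, p, hp⟩ := O.covers x
  exact ⟨⟨c, p⟩, hc, hp⟩

/-- The singular dimension `dim (T_x̃ Ũ)^{Γ_x}` of `x`, computed at a chosen lift `x̃` of `x` to a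
chosen chart of the atlas. It does not depend on these choices: restricting the chart to a small
`Γ_x`-invariant neighbourhood of `x̃` gives a chart centred at `x`, with the same fixed space. -/
noncomputable def sdim (O : Orbifold n X) (x : X) : ℕ :=
  Module.finrank ℝ
    ((O.exists_lift x).choose.1.fixedTangent (O.exists_lift x).choose.2)

/-- The stratum `Σ_k` of points of singular dimension `k`. For `k < n` these are the singular
strata; for `k = n` it is the set of non-singular points. -/
def stratum (O : Orbifold n X) (k : ℕ) : Set X := {y | O.sdim y = k}

/-- `Σ(x)`: the connected component of `x` in its stratum `Σ_{sdim x}`. -/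
def stratumComponent (O : Orbifold n X) (x : X) : Set X :=
  connectedComponentIn (O.stratum (O.sdim x)) x

/-- `f` is a smooth orbifold map: it is continuous, and around each point there are charts between
which it lifts to a smooth map (then `f` maps the image of `c` into that of `d`). -/
def IsSmoothMap (O : Orbifold m X) (P : Orbifold n Y) (f : X → Y) : Prop :=
  Continuous f ∧ ∀ x : X, ∃ c ∈ O.atlas, ∃ d ∈ P.atlas, x ∈ c.image ∧ f x ∈ d.image ∧
    ∃ F : c.domain → d.domain,
      ContMDiff 𝓘(ℝ, EuclideanSpace ℝ (Fin m)) 𝓘(ℝ, EuclideanSpace ℝ (Fin n)) ∞ F ∧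
      ∀ p, d.proj (F p) = f (c.proj p)

/-- `f` is an orbifold diffeomorphism: a smooth orbifold map with a smooth inverse. -/
def IsDiffeo (O : Orbifold m X) (P : Orbifold n Y) (f : X → Y) : Prop :=
  IsSmoothMap O P f ∧ ∃ g : Y → X, IsSmoothMap P O g ∧ g ∘ f = id ∧ f ∘ g = id

/-- `F` is a smooth orbifold map `O × [0,1] → P`. The product orbifold has the charts `Ũ × J` with
projection `φ_U × id`, where `(Ũ, Γ, φ_U)` is a chart of `O`, the group `Γ` acts on the first
factor, and `J ⊆ [0,1]` is relatively open and connected. -/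
def IsSmoothHomotopy (O : Orbifold m X) (P : Orbifold n Y) (F : X × unitInterval → Y) : Prop :=
  Continuous F ∧ ∀ (x : X) (t : unitInterval),
    ∃ c ∈ O.atlas, ∃ J : TopologicalSpace.Opens unitInterval, ∃ d ∈ P.atlas,
      x ∈ c.image ∧ t ∈ J ∧ IsConnected (J : Set unitInterval) ∧ F (x, t) ∈ d.image ∧
      ∃ G : c.domain × J → d.domain,
        ContMDiff (𝓘(ℝ, EuclideanSpace ℝ (Fin m)).prod (𝓡∂ 1))
          𝓘(ℝ, EuclideanSpace ℝ (Fin n)) ∞ G ∧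
        ∀ (p : c.domain) (s : J), d.proj (G (p, s)) = F (c.proj p, s)

/-- `F` is an isotopy from `f` to `g`: a smooth homotopy through orbifold diffeomorphisms. -/
def IsIsotopy (O : Orbifold m X) (P : Orbifold n Y) (f g : X → Y) (F : X × unitInterval → Y) :
    Prop :=
  IsSmoothHomotopy O P F ∧ (∀ t, IsDiffeo O P fun x => F (x, t)) ∧
    (∀ x, F (x, 0) = f x) ∧ ∀ x, F (x, 1) = g x

/-- The support of a self-map: the closure of the set of moved points. -/
def supp (f : X → X) : Set X := closure {x | f x ≠ x}

/-- The support of a family of self-maps: the closure of the set of points that are moved at some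
time. -/
def isotopySupp (F : X × unitInterval → X) : Set X := closure {x | ∃ t, F (x, t) ≠ x}

/-- `Diff_c(O)`: the compactly supported diffeomorphisms of `O` that are isotopic to the identity
through a compactly supported isotopy. -/
def diffC (O : Orbifold n X) : Set (X → X) :=
  {f | IsDiffeo O O f ∧ IsCompact (supp f) ∧
    ∃ F : X × unitInterval → X, IsIsotopy O O id f F ∧ IsCompact (isotopySupp F)}

end Orbifold

/-! Bochner's linearization gives a chart of the atlas around `x` whose group `Γ` acts linearly and
fixes the centre `0`, which lies over `x`. The isotropy group of a point `v` of this chart is a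
subgroup of `Γ`, so its fixed space contains that of `Γ`. If `v` has the singular dimension of the
centre, the two spaces coincide; as `v` lies in the first, it is fixed by all of `Γ`
(`rep_apply_eq_of_sdim_eq`). Hence nearby points of the stratum of `x` come from small vectors fixed
by `Γ`.

For such a `v`, take a `Γ`-invariant bump function `χ` with `χ 0 = 1` and move `u` to `u + t χ(u)
v`. This is equivariant because `χ` and `v` are invariant, and it is a diffeomorphism when `v` is
small, being a contractive perturbation of the identity. It takes `0` to `v` at `t = 1`, descends to
the quotient, and extends by the identity to an isotopy of the orbifold
(`exists_isIsotopy_of_isLinear`).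

Two facts about atlases are needed: the linear charts belong to the maximal atlas
(`mem_atlas_of_embeds`), and the singular dimension does not depend on the lift that computes it
(`sdim_proj`). -/

/-! ### Calculus on open subsets of vector spaces -/

section OpensCalculus

open TopologicalSpace Filter

section Extend

variable {E F : Type*} [TopologicalSpace E] [Zero F]

/-- The extension by zero of a map that is defined on an open subset of a vector space. -/
noncomputable def zeroExtend {U : Opens E} (f : U → F) : E → F :=
  Function.extend Subtype.val f 0

theorem zeroExtend_coe {U : Opens E} (f : U → F) (p : U) : zeroExtend f p = f p :=
  Subtype.val_injective.extend_apply f 0 p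

end Extend

variable {E F G : Type*} [NormedAddCommGroup E] [NormedSpace ℝ E]
  [NormedAddCommGroup F] [NormedSpace ℝ F] [NormedAddCommGroup G] [NormedSpace ℝ G]

theorem contMDiff_iff_contDiffAt_zeroExtend {U : Opens E} {f : U → F} :
    ContMDiff 𝓘(ℝ, E) 𝓘(ℝ, F) ∞ f ↔ ∀ p : U, ContDiffAt ℝ ∞ (zeroExtend f) p := by
  have h : f = fun p : U => zeroExtend f p.1 := funext fun p => (zeroExtend_coe f p).symm
  refine forall_congr' fun p => ?_
  rw [h, contMDiffAt_subtype_iff, ← h, contMDiffAt_iff_contDiffAt]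

/-- `f` is a smooth map between open subsets of vector spaces. -/
abbrev SmoothOpens {U : Opens E} {V : Opens F} (f : U → V) : Prop :=
  ContMDiff 𝓘(ℝ, E) 𝓘(ℝ, F) ∞ f

/-- The differential of a map between open subsets of vector spaces. -/
noncomputable def opensDeriv {U : Opens E} {V : Opens F} (f : U → V) (p : U) : E →L[ℝ] F :=
  mfderiv 𝓘(ℝ, E) 𝓘(ℝ, F) f p

theorem smoothOpens_iff {U : Opens E} {V : Opens F} {f : U → V} :
    SmoothOpens f ↔ ∀ p : U, ContDiffAt ℝ ∞ (zeroExtend (Subtype.val ∘ f)) p := by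
  rw [SmoothOpens, ← ContMDiff.subtypeVal_comp_iff, contMDiff_iff_contDiffAt_zeroExtend]

theorem SmoothOpens.hasFDerivAt {U : Opens E} {V : Opens F} {f : U → V} (hf : SmoothOpens f)
    (p : U) : HasFDerivAt (zeroExtend (Subtype.val ∘ f)) (opensDeriv f p) p := by
  have h : MDifferentiableAt 𝓘(ℝ, E) 𝓘(ℝ, F) f p := hf.mdifferentiable (by simp) p
  have h2 : HasFDerivWithinAt (writtenInExtChartAt 𝓘(ℝ, E) 𝓘(ℝ, F) p f) (opensDeriv f p)
      (range 𝓘(ℝ, E)) (p : E) := h.hasMFDerivAt.2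
  rw [ModelWithCorners.Boundaryless.range_eq_univ, hasFDerivWithinAt_univ] at h2
  refine HasFDerivAt.congr_of_eventuallyEq (f := writtenInExtChartAt 𝓘(ℝ, E) 𝓘(ℝ, F) p f) h2 ?_
  filter_upwards [U.2.mem_nhds p.2] with v hv
  have e1 : (extChartAt 𝓘(ℝ, E) p).symm v = ⟨v, hv⟩ := by
    have : extChartAt 𝓘(ℝ, E) p ⟨v, hv⟩ = v := rfl
    conv_lhs => rw [← this]
    exact (extChartAt 𝓘(ℝ, E) p).left_inv (by
      rw [extChartAt_source, Opens.chartAt_eq, OpenPartialHomeomorph.subtypeRestr_source,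
        chartAt_self_eq]
      exact mem_univ _)
  have : writtenInExtChartAt 𝓘(ℝ, E) 𝓘(ℝ, F) p f v
      = (f ((extChartAt 𝓘(ℝ, E) p).symm v) : F) := rfl
  rw [this, e1]
  exact zeroExtend_coe _ (⟨v, hv⟩ : U)

theorem SmoothOpens.fderiv_eq {U : Opens E} {V : Opens F} {f : U → V} (hf : SmoothOpens f)
    (p : U) : fderiv ℝ (zeroExtend (Subtype.val ∘ f)) p = opensDeriv f p :=
  (hf.hasFDerivAt p).fderiv

theorem SmoothOpens.opensDeriv_eq {U : Opens E} {V : Opens F} {f : U → V} (hf : SmoothOpens f)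
    {p : U} {g : E → F} {A : E →L[ℝ] F} (hg : HasFDerivAt g A p)
    (hfg : ∀ᶠ q : U in 𝓝 p, (f q : F) = g q) : opensDeriv f p = A := by
  refine (hf.hasFDerivAt p).unique (hg.congr_of_eventuallyEq ?_)
  have : ∀ᶠ v in map (Subtype.val : U → E) (𝓝 p), zeroExtend (Subtype.val ∘ f) v = g v := by
    rw [eventually_map]
    filter_upwards [hfg] with q hq
    simpa [zeroExtend_coe] using hq
  rwa [U.isOpenEmbedding'.map_nhds_eq] at this

theorem opensDeriv_comp {U : Opens E} {V : Opens F} {W : Opens G} {g : V → W} {f : U → V}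
    (hg : SmoothOpens g) (hf : SmoothOpens f) (p : U) :
    opensDeriv (g ∘ f) p = (opensDeriv g (f p)).comp (opensDeriv f p) :=
  mfderiv_comp p (hg.mdifferentiable (by simp) _) (hf.mdifferentiable (by simp) _)

theorem opensDeriv_id {U : Opens E} (p : U) : opensDeriv (id : U → U) p = .id ℝ E :=
  mfderiv_id

theorem opensDeriv_congr {U : Opens E} {V : Opens F} {f g : U → V} {p : U} (h : f =ᶠ[𝓝 p] g) :
    opensDeriv f p = opensDeriv g p := by
  have hp := h.eq_of_nhds
  have := h.mfderiv_eq (I := 𝓘(ℝ, E)) (I' := 𝓘(ℝ, F))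
  exact this

theorem SmoothOpens.hasStrictFDerivAt {U : Opens E} {V : Opens F} {f : U → V}
    (hf : SmoothOpens f) (p : U) :
    HasStrictFDerivAt (zeroExtend (Subtype.val ∘ f)) (opensDeriv f p) p := by
  rw [← hf.fderiv_eq]
  exact (smoothOpens_iff.1 hf p).hasStrictFDerivAt (by simp)

variable [FiniteDimensional ℝ E]

theorem exists_equiv_of_injective {A : E →L[ℝ] E} (hA : Function.Injective A) :
    ∃ A' : E ≃L[ℝ] E, (A' : E →L[ℝ] E) = A :=
  ⟨(LinearEquiv.ofInjectiveEndo A.toLinearMap hA).toContinuousLinearEquiv, by ext; rfl⟩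

/-- Source and target lie in the same finite-dimensional space, so injective differentials are
invertible and the inverse function theorem applies. -/
theorem SmoothOpens.isOpenMap {U V : Opens E} {f : U → V} (hf : SmoothOpens f)
    (hinj : ∀ p, Function.Injective (opensDeriv f p)) : IsOpenMap f := by
  have : CompleteSpace E := FiniteDimensional.complete ℝ E
  rw [V.isOpenEmbedding'.isOpenMap_iff, isOpenMap_iff_nhds_le]
  intro p
  obtain ⟨A, hA⟩ := exists_equiv_of_injective (hinj p)
  have h := hf.hasStrictFDerivAt p
  rw [← hA] at h
  have h1 := h.map_nhds_eq_of_equiv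
  rw [zeroExtend_coe, ← U.isOpenEmbedding'.map_nhds_eq, map_map] at h1
  have : zeroExtend (Subtype.val ∘ f) ∘ (Subtype.val : U → E) = Subtype.val ∘ f :=
    funext fun q => zeroExtend_coe _ _
  rw [this] at h1
  exact h1.ge

/-- A continuous lift of a smooth map along a map with injective differentials is smooth. -/
theorem SmoothOpens.of_comp {U : Opens F} {V W : Opens E} {l : V → W} {h : U → V}
    (hl : SmoothOpens l) (hinj : ∀ p, Function.Injective (opensDeriv l p))
    (hh : Continuous h) (hlh : SmoothOpens (l ∘ h)) : SmoothOpens h := by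
  have : CompleteSpace E := FiniteDimensional.complete ℝ E
  rw [smoothOpens_iff]
  intro p
  obtain ⟨A, hA⟩ := exists_equiv_of_injective (hinj (h p))
  have hd := hl.hasFDerivAt (h p)
  rw [← hA] at hd
  have hs := smoothOpens_iff.1 hl (h p)
  -- Near `p`, `h` is the local inverse of `l` applied to `l ∘ h`; continuity of `h` keeps its
  -- values in the domain of invertibility.
  let Φ := hs.toOpenPartialHomeomorph (zeroExtend (Subtype.val ∘ l)) hd (by simp)
  have hp : (h p : E) ∈ Φ.source := hs.mem_toOpenPartialHomeomorph_source hd (by simp)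
  have hΦ : ∀ q : V, Φ q = l q := fun q => zeroExtend_coe _ _
  have hsymm : ContDiffAt ℝ ∞ Φ.symm (l (h p)) := by
    rw [← hΦ]
    have e := Φ.left_inv hp
    refine Φ.contDiffAt_symm (f₀' := A) (Φ.map_source hp) ?_ ?_
    · rw [e]; exact hd
    · rw [e]; exact hs
  have hc := smoothOpens_iff.1 hlh p
  have hc2 : ContDiffAt ℝ ∞ (Φ.symm ∘ zeroExtend (Subtype.val ∘ (l ∘ h))) p := by
    refine ContDiffAt.comp _ ?_ hc
    rw [zeroExtend_coe]
    exact hsymm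
  refine hc2.congr_of_eventuallyEq ?_
  rw [EventuallyEq, ← U.isOpenEmbedding'.map_nhds_eq, eventually_map]
  have hcont : ContinuousAt (fun q => (h q : E)) p := (continuous_subtype_val.comp hh).continuousAt
  filter_upwards [hcont.eventually (Φ.open_source.mem_nhds hp)] with q hq
  have hq' : (h q : E) ∈ Φ.source := hq
  rw [Function.comp_apply, zeroExtend_coe, zeroExtend_coe, Function.comp_apply,
    Function.comp_apply, Function.comp_apply, ← hΦ, Φ.left_inv hq']

end OpensCalculus

/-! ### Linearization of finite group actions -/

section LinearModel

open TopologicalSpace Filter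

variable {E : Type*} [NormedAddCommGroup E] [NormedSpace ℝ E]
  {Ω : Opens E} {G : Type*} [Group G] [MulAction G Ω]

/-- The linear representation on the tangent space at a common fixed point of a smooth group
action. -/
noncomputable def isotropyRep (hs : ∀ γ : G, SmoothOpens fun p : Ω => γ • p) (q : Ω)
    (hq : ∀ γ : G, γ • q = q) : G →* (E →L[ℝ] E) where
  toFun γ := opensDeriv (fun p : Ω => γ • p) q
  map_one' := by
    have : (fun p : Ω => (1 : G) • p) = id := funext fun p => one_smul _ _
    rw [this, opensDeriv_id]
    rfl
  map_mul' γ δ := by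
    have : (fun p : Ω => (γ * δ) • p) = (fun p : Ω => γ • p) ∘ fun p : Ω => δ • p :=
      funext fun p => mul_smul _ _ _
    rw [this, opensDeriv_comp (hs γ) (hs δ), hq]
    rfl

theorem MonoidHom.clm_apply_apply (ρ : G →* (E →L[ℝ] E)) (γ δ : G) (v : E) :
    ρ γ (ρ δ v) = ρ (γ * δ) v := by
  rw [map_mul]; rfl

/-- The average over the group of the maps `p ↦ ρ(γ)⁻¹ (γ p - q)`. -/
noncomputable def linearizer [Fintype G] (ρ : G →* (E →L[ℝ] E)) (q : Ω) (u : E) : E :=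
  (Fintype.card G : ℝ)⁻¹ •
    ∑ γ : G, ρ γ⁻¹ (zeroExtend (Subtype.val ∘ fun p : Ω => γ • p) u - q)

/-- Reindexing the average by `δ ↦ δ * γ` pulls out the factor `ρ γ`. -/
theorem linearizer_smul [Fintype G] (ρ : G →* (E →L[ℝ] E)) (q : Ω) (γ : G) (u : Ω) :
    linearizer ρ q (γ • u : Ω) = ρ γ (linearizer ρ q u) := by
  simp only [linearizer, zeroExtend_coe, Function.comp_apply, map_smul, map_sum,
    MonoidHom.clm_apply_apply, smul_smul]
  congr 1
  refine Fintype.sum_equiv (Equiv.mulRight γ) _ _ fun δ => ?_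
  simp

theorem linearizer_self [Fintype G] (ρ : G →* (E →L[ℝ] E)) (q : Ω) (hq : ∀ γ : G, γ • q = q) :
    linearizer ρ q q = 0 := by
  simp [linearizer, zeroExtend_coe, hq]

theorem contDiffAt_linearizer [Fintype G] (hs : ∀ γ : G, SmoothOpens fun p : Ω => γ • p)
    (ρ : G →* (E →L[ℝ] E)) (q u : Ω) : ContDiffAt ℝ ∞ (linearizer ρ q) u := by
  unfold linearizer
  refine contDiffAt_const.smul (ContDiffAt.sum fun γ _ => ?_)
  exact (ρ γ⁻¹).contDiff.contDiffAt.comp _ ((smoothOpens_iff.1 (hs γ) u).sub contDiffAt_const)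

/-- Each summand has differential `ρ γ⁻¹ ∘ ρ γ = id` at `q`, hence so does the average; this makes
it a local coordinate. -/
theorem hasFDerivAt_linearizer [Fintype G] (hs : ∀ γ : G, SmoothOpens fun p : Ω => γ • p) (q : Ω)
    (hq : ∀ γ : G, γ • q = q) :
    HasFDerivAt (linearizer (isotropyRep hs q hq) q) (ContinuousLinearMap.id ℝ E) q := by
  have h : HasFDerivAt (linearizer (isotropyRep hs q hq) q) ((Fintype.card G : ℝ)⁻¹ •
      ∑ γ : G, (isotropyRep hs q hq γ⁻¹).comp (isotropyRep hs q hq γ)) q := by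
    unfold linearizer
    refine HasFDerivAt.const_smul (HasFDerivAt.fun_sum fun γ _ => ?_) _
    exact (isotropyRep hs q hq γ⁻¹).hasFDerivAt.comp _ (((hs γ).hasFDerivAt q).sub_const _)
  convert h using 1
  have : ∀ γ : G, (isotropyRep hs q hq γ⁻¹).comp (isotropyRep hs q hq γ) = .id ℝ E := by
    intro γ
    have := map_mul (isotropyRep hs q hq) γ⁻¹ γ
    rw [inv_mul_cancel, map_one] at this
    exact this.symm
  simp only [this, Finset.sum_const, Finset.card_univ]
  rw [← Nat.cast_smul_eq_nsmul ℝ, smul_smul, inv_mul_cancel₀ (by simp), one_smul]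

/-- Bochner's linearization theorem: a smooth finite group action is linear in suitable coordinates
around a fixed point. -/
theorem exists_linear_model [FiniteDimensional ℝ E] [Finite G]
    (hs : ∀ γ : G, SmoothOpens fun p : Ω => γ • p)
    (q : Ω) (hq : ∀ γ : G, γ • q = q) {N : Set Ω} (hN : N ∈ 𝓝 q) :
    ∃ (B : Opens E) (h0 : (0 : E) ∈ B) (κ : B → Ω), Convex ℝ (B : Set E) ∧ κ ⟨0, h0⟩ = q ∧
      SmoothOpens κ ∧ (∀ p, Function.Injective (opensDeriv κ p)) ∧ IsOpenEmbedding κ ∧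
      range κ ⊆ N ∧ ∀ (γ : G) (v : B), ∃ hv : isotropyRep hs q hq γ v ∈ B,
        κ ⟨isotropyRep hs q hq γ v, hv⟩ = γ • κ v := by
  have : CompleteSpace E := FiniteDimensional.complete ℝ E
  cases nonempty_fintype G
  set ρ := isotropyRep hs q hq with hρ
  set ψ := linearizer ρ q with hψ
  have hsm : ∀ u : Ω, ContDiffAt ℝ ∞ ψ u := contDiffAt_linearizer hs ρ q
  have hd : HasFDerivAt ψ (ContinuousLinearEquiv.refl ℝ E : E →L[ℝ] E) q :=
    hasFDerivAt_linearizer hs q hq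
  let Φ := (hsm q).toOpenPartialHomeomorph ψ hd (by simp)
  have hqs : (q : E) ∈ Φ.source := (hsm q).mem_toOpenPartialHomeomorph_source hd (by simp)
  have hΦ : ∀ u, Φ u = ψ u := fun u => rfl
  have hΦq : Φ q = 0 := linearizer_self ρ q hq
  -- The whole orbit must stay where `Φ` is injective, so that equivariance passes to the inverse;
  -- invertible differentials make the inverse smooth at every point, not only at `0`.
  let S : Set Ω := {u | u ∈ N ∧ (∀ γ : G, ((γ • u : Ω) : E) ∈ Φ.source) ∧
    fderiv ℝ ψ u ∈ range ((↑) : (E ≃L[ℝ] E) → E →L[ℝ] E)}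
  have hS : S ∈ 𝓝 q := by
    refine inter_mem hN (inter_mem ?_ ?_)
    · refine eventually_all.2 fun γ => ?_
      have : ContinuousAt (fun u : Ω => ((γ • u : Ω) : E)) q :=
        (continuous_subtype_val.comp (hs γ).continuous).continuousAt
      refine this.preimage_mem_nhds (Φ.open_source.mem_nhds ?_)
      rw [hq]; exact hqs
    · have : ContinuousAt (fun u : Ω => fderiv ℝ ψ u) q := by
        have h1 : ContinuousAt (fderiv ℝ ψ) q :=
          ((hsm q).fderiv_right (m := 0) (by simp)).continuousAt
        exact h1.comp continuous_subtype_val.continuousAt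
      refine this.preimage_mem_nhds (ContinuousLinearEquiv.isOpen.mem_nhds ?_)
      exact ⟨_, hd.fderiv.symm⟩
  have hS' : Subtype.val '' S ∈ 𝓝 (q : E) := by
    rw [← Ω.isOpenEmbedding'.map_nhds_eq]
    exact image_mem_map hS
  have h0t : (0 : E) ∈ Φ.target := hΦq ▸ Φ.map_source hqs
  have hT : Φ.target ∩ Φ.symm ⁻¹' (Subtype.val '' S) ∈ 𝓝 (0 : E) := by
    refine inter_mem (Φ.open_target.mem_nhds h0t) ?_
    refine (Φ.continuousAt_symm h0t).preimage_mem_nhds ?_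
    rwa [← hΦq, Φ.left_inv hqs]
  obtain ⟨r, hr, hball⟩ := Metric.mem_nhds_iff.1 hT
  -- Intersecting the linear preimages of a ball makes it invariant and keeps it open and convex.
  let B : Opens E := ⟨⋂ γ : G, ρ γ ⁻¹' Metric.ball 0 r,
    isOpen_iInter_of_finite fun γ => Metric.isOpen_ball.preimage (ρ γ).continuous⟩
  have hBmem : ∀ v : E, v ∈ B ↔ ∀ γ, ρ γ v ∈ Metric.ball 0 r := fun v => mem_iInter
  have hB : ∀ v ∈ B, v ∈ Φ.target ∧ Φ.symm v ∈ Subtype.val '' S := by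
    intro v hv
    have := (hBmem v).1 hv 1
    rw [map_one] at this
    exact hball this
  have hBρ : ∀ γ, ∀ v ∈ B, ρ γ v ∈ B := by
    intro γ v hv
    rw [hBmem] at hv ⊢
    intro δ
    rw [MonoidHom.clm_apply_apply]
    exact hv _
  have h0 : (0 : E) ∈ B := (hBmem 0).2 fun γ => by simpa using hr
  have hBS : ∀ v : B, ∃ u : Ω, u ∈ S ∧ (u : E) = Φ.symm v := fun v => (hB v v.2).2
  choose κ hκS hκ using hBS
  have hψκ : ∀ v : B, ψ (κ v) = v := fun v => by
    rw [hκ, ← hΦ, Φ.right_inv (hB v v.2).1]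
  have hκsm : SmoothOpens κ := by
    rw [smoothOpens_iff]
    intro v
    obtain ⟨A, hA⟩ := (hκS v).2.2
    have h1 : ContDiffAt ℝ ∞ Φ.symm v := by
      refine Φ.contDiffAt_symm (f₀' := A) (hB v v.2).1 ?_ ?_
      · rw [← hκ, hA]; exact ((hsm _).differentiableAt (by simp)).hasFDerivAt
      · rw [← hκ]; exact hsm _
    refine h1.congr_of_eventuallyEq ?_
    filter_upwards [B.2.mem_nhds v.2] with w hw
    exact (zeroExtend_coe _ (⟨w, hw⟩ : B)).trans (hκ ⟨w, hw⟩)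
  have hκinj : ∀ p, Function.Injective (opensDeriv κ p) := by
    intro p
    have h1 := hκsm.hasFDerivAt p
    have h2 : HasFDerivAt ψ (fderiv ℝ ψ (κ p)) (zeroExtend (Subtype.val ∘ κ) (p : E)) := by
      rw [zeroExtend_coe]
      exact ((hsm _).differentiableAt (by simp)).hasFDerivAt
    have h3 := h2.comp _ h1
    have h4 : HasFDerivAt (ψ ∘ zeroExtend (Subtype.val ∘ κ)) (.id ℝ E) (p : E) := by
      refine (hasFDerivAt_id (p : E)).congr_of_eventuallyEq ?_
      filter_upwards [B.2.mem_nhds p.2] with w hw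
      have := zeroExtend_coe (Subtype.val ∘ κ) (⟨w, hw⟩ : B)
      rw [Function.comp_apply]
      simp only at this
      rw [this]
      exact hψκ ⟨w, hw⟩
    have h5 := h3.unique h4
    refine Function.LeftInverse.injective (g := fderiv ℝ ψ (κ p)) fun w => ?_
    exact DFunLike.congr_fun h5 w
  have hκi : Function.Injective κ := fun a b hab => by
    apply Subtype.ext
    rw [← hψκ, hab, hψκ]
  refine ⟨B, h0, κ, ?_, ?_, hκsm, hκinj, ?_, ?_, ?_⟩
  · exact convex_iInter fun γ =>
      (convex_ball 0 r).is_linear_preimage (ρ γ).isBoundedLinearMap.toIsLinearMap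
  · apply Subtype.ext
    rw [hκ]
    simp only
    rw [← hΦq, Φ.left_inv hqs]
  · exact .of_continuous_injective_isOpenMap hκsm.continuous hκi (hκsm.isOpenMap hκinj)
  · rintro _ ⟨v, rfl⟩
    exact (hκS v).1
  · intro γ v
    refine ⟨hBρ γ v v.2, Subtype.ext ?_⟩
    rw [hκ]
    have h1 : ((γ • κ v : Ω) : E) ∈ Φ.source := (hκS v).2.1 γ
    have h2 : Φ (γ • κ v : Ω) = ρ γ v := by
      rw [hΦ, hψ, linearizer_smul, ← hψ, hψκ]
    rw [← Φ.left_inv h1, h2]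

end LinearModel

/-! ### Embeddings of charts and small linear charts -/

namespace OrbifoldChart

open TopologicalSpace Filter

variable {n : ℕ} {X : Type*} [TopologicalSpace X]

theorem smoothOpens_smul (c : OrbifoldChart n X) (γ : c.Γ) :
    SmoothOpens fun p : c.domain => γ • p := c.smooth_smul γ

instance (c : OrbifoldChart n X) : ContinuousConstSMul c.Γ c.domain :=
  ⟨fun γ => (c.smooth_smul γ).continuous⟩

theorem proj_eq_iff (c : OrbifoldChart n X) {p q : c.domain} :
    c.proj p = c.proj q ↔ ∃ γ : c.Γ, γ • p = q := by
  constructor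
  · intro h
    have h' := c.isOpenEmbedding_quotient.injective
      (a₁ := Quotient.mk _ q) (a₂ := Quotient.mk _ p) h.symm
    exact (MulAction.orbitRel_apply.1 (Quotient.exact h'))
  · rintro ⟨γ, rfl⟩
    exact (c.proj_smul γ p).symm

theorem isOpenMap_proj (c : OrbifoldChart n X) : IsOpenMap c.proj :=
  c.isOpenEmbedding_quotient.isOpenMap.comp
    (isOpenMap_quotient_mk'_mul (Γ := c.Γ) (T := c.domain))

theorem map_nhds_proj (c : OrbifoldChart n X) (p : c.domain) : map c.proj (𝓝 p) = 𝓝 (c.proj p) :=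
  le_antisymm c.continuous_proj.continuousAt (c.isOpenMap_proj.nhds_le p)

theorem mem_image (c : OrbifoldChart n X) (p : c.domain) : c.proj p ∈ c.image := mem_range_self p

section IsEmbedding

variable {b c d : OrbifoldChart n X} {l : c.domain → d.domain}

theorem IsEmbedding.smoothOpens (h : IsEmbedding c d l) : SmoothOpens l := h.smooth

theorem IsEmbedding.opensDeriv_injective (h : IsEmbedding c d l) (p : c.domain) :
    Function.Injective (opensDeriv l p) := h.injective_mfderiv p

theorem IsEmbedding.isOpenMap (h : IsEmbedding c d l) : IsOpenMap l :=
  h.smoothOpens.isOpenMap h.opensDeriv_injective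

theorem IsEmbedding.proj_apply (h : IsEmbedding c d l) (p : c.domain) :
    d.proj (l p) = c.proj p := congrFun h.proj_comp p

theorem IsEmbedding.image_subset (h : IsEmbedding c d l) : c.image ⊆ d.image := by
  rintro _ ⟨p, rfl⟩
  exact ⟨l p, h.proj_apply p⟩

theorem IsEmbedding.comp (h : IsEmbedding c d l) {k : b.domain → c.domain}
    (h' : IsEmbedding b c k) : IsEmbedding b d (l ∘ k) where
  smooth := ContMDiff.comp h.smooth h'.smooth
  injective_mfderiv p := by
    have := opensDeriv_comp h.smoothOpens h'.smoothOpens p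
    change Function.Injective (opensDeriv (l ∘ k) p)
    rw [this]
    exact (h.opensDeriv_injective _).comp (h'.opensDeriv_injective p)
  isEmbedding := h.isEmbedding.comp h'.isEmbedding
  proj_comp := by rw [← Function.comp_assoc, h.proj_comp, h'.proj_comp]

/-- An embedding of charts whose range lies in that of another one factors through it. -/
theorem IsEmbedding.exists_lift (h : IsEmbedding c d l) {k : b.domain → d.domain}
    (h' : IsEmbedding b d k) (hr : range k ⊆ range l) :
    ∃ m : b.domain → c.domain, IsEmbedding b c m ∧ l ∘ m = k := by
  choose m hm using fun p => hr (mem_range_self p)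
  have hlm : l ∘ m = k := funext hm
  have hme : Topology.IsEmbedding m := by
    have h1 : Continuous m := by
      rw [h.isEmbedding.continuous_iff, hlm]
      exact h'.isEmbedding.continuous
    exact .of_comp h1 h.isEmbedding.continuous (hlm ▸ h'.isEmbedding)
  have hms : SmoothOpens m :=
    h.smoothOpens.of_comp h.opensDeriv_injective hme.continuous (by rw [hlm]; exact h'.smooth)
  refine ⟨m, ⟨hms, fun p => ?_, hme, ?_⟩, hlm⟩
  · change Function.Injective (opensDeriv m p)
    have := opensDeriv_comp h.smoothOpens hms p
    have h2 := h'.opensDeriv_injective p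
    rw [← hlm, this] at h2
    exact Function.Injective.of_comp h2
  · rw [← h.proj_comp, Function.comp_assoc, hlm, h'.proj_comp]

theorem isEmbedding_smul (c : OrbifoldChart n X) (γ : c.Γ) :
    IsEmbedding c c fun p : c.domain => γ • p where
  smooth := c.smooth_smul γ
  injective_mfderiv p := by
    change Function.Injective (opensDeriv (fun p : c.domain => γ • p) p)
    have h : (fun p : c.domain => γ⁻¹ • p) ∘ (fun p : c.domain => γ • p) = id :=
      funext fun p => inv_smul_smul γ p
    have := opensDeriv_comp (c.smoothOpens_smul γ⁻¹) (c.smoothOpens_smul γ) p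
    rw [h, opensDeriv_id] at this
    refine Function.Injective.of_comp (f := opensDeriv (fun p : c.domain => γ⁻¹ • p) (γ • p)) ?_
    rw [← ContinuousLinearMap.coe_comp, ← this]
    exact Function.injective_id
  isEmbedding := (Homeomorph.smul γ).isEmbedding
  proj_comp := funext fun p => c.proj_smul γ p

end IsEmbedding

/-- The representation of the isotropy group on the tangent space. -/
noncomputable def stabilizerRep (c : OrbifoldChart n X) (q : c.domain) :
    MulAction.stabilizer c.Γ q →*
      (EuclideanSpace ℝ (Fin n) →L[ℝ] EuclideanSpace ℝ (Fin n)) :=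
  isotropyRep (G := MulAction.stabilizer c.Γ q) (fun γ => c.smoothOpens_smul (γ : c.Γ)) q
    fun γ => γ.2

theorem tangentAction_eq (c : OrbifoldChart n X) (p : c.domain) (γ : c.Γ) :
    c.tangentAction p γ = opensDeriv (fun q : c.domain => γ • q) p := rfl

/-- The interior of the fixed set of `γ` is closed: at a limit point `γ` has a fixed point, with
identity differential by continuity, so the linear model makes it trivial nearby. Connectedness
spreads this to the whole domain. It makes restricted actions effective. -/
theorem eq_one_of_eventually_smul_eq (c : OrbifoldChart n X) (γ : c.Γ) (p : c.domain)
    (h : ∀ᶠ u in 𝓝 p, γ • u = u) : γ = 1 := by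
  have : PreconnectedSpace c.domain :=
    isPreconnected_iff_preconnectedSpace.1 c.isConnected_domain.isPreconnected
  let S : Set c.domain := interior {u | γ • u = u}
  have hS : IsClosed S := by
    refine isClosed_of_closure_subset fun r hr => ?_
    have hfix : r ∈ {u : c.domain | γ • u = u} := by
      have hcl : IsClosed {u : c.domain | γ • u = u} :=
        isClosed_eq (continuous_const_smul γ) continuous_id
      exact closure_minimal interior_subset hcl hr
    let δ : MulAction.stabilizer c.Γ r := ⟨γ, hfix⟩
    have hδ : c.stabilizerRep r δ = 1 := by
      change opensDeriv (fun q : c.domain => γ • q) r = .id ℝ _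
      have hcont : ContinuousAt (fun u : c.domain => opensDeriv (fun q : c.domain => γ • q) u)
          r := by
        have h1 := smoothOpens_iff.1 (c.smoothOpens_smul γ) r
        have h2 := (h1.fderiv_right (m := 0) (by simp)).continuousAt
        have h3 : ContinuousAt (fun u : c.domain =>
            fderiv ℝ (zeroExtend (Subtype.val ∘ fun q : c.domain => γ • q)) u) r :=
          h2.comp continuous_subtype_val.continuousAt
        refine h3.congr (Eventually.of_forall fun u => ?_)
        exact (c.smoothOpens_smul γ).fderiv_eq u
      refine closure_minimal (t := {A | A = ContinuousLinearMap.id ℝ (EuclideanSpace ℝ (Fin n))})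
        ?_ isClosed_singleton (hcont.continuousWithinAt.mem_closure_image hr)
      rintro _ ⟨u, hu, rfl⟩
      change opensDeriv (fun q : c.domain => γ • q) u = _
      rw [← opensDeriv_id u]
      refine opensDeriv_congr ?_
      exact mem_interior_iff_mem_nhds.1 hu
    obtain ⟨B, h0, κ, -, hκ0, -, -, hκo, -, hκ⟩ := exists_linear_model
      (G := MulAction.stabilizer c.Γ r) (fun γ => c.smoothOpens_smul (γ : c.Γ)) r
      (fun γ => γ.2) univ_mem
    have hr' : r ∈ range κ := ⟨_, hκ0⟩
    refine mem_interior.2 ⟨range κ, ?_, hκo.isOpen_range, hr'⟩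
    rintro _ ⟨v, rfl⟩
    obtain ⟨hv, h⟩ := hκ δ v
    have e : (⟨_, hv⟩ : B) = v := by
      apply Subtype.ext
      change c.stabilizerRep r δ v = v
      rw [hδ]; rfl
    rw [e] at h
    exact h.symm
  have huniv : S = univ :=
    IsClopen.eq_univ ⟨hS, isOpen_interior⟩ ⟨p, mem_interior_iff_mem_nhds.2 h⟩
  refine eq_of_smul_eq_smul (α := c.domain) fun u => ?_
  rw [one_smul]
  have hu : u ∈ S := huniv ▸ mem_univ u
  exact interior_subset (s := {u : c.domain | γ • u = u}) hu

/-- A chart whose domain contains `0` and whose group acts by restrictions of linear maps. -/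
structure IsLinear (w : OrbifoldChart n X)
    (ρ : w.Γ →* (EuclideanSpace ℝ (Fin n) →L[ℝ] EuclideanSpace ℝ (Fin n))) : Prop where
  zero_mem : 0 ∈ w.domain
  coe_smul : ∀ (γ : w.Γ) (v : w.domain), ((γ • v : w.domain) : EuclideanSpace ℝ (Fin n)) = ρ γ v

theorem IsLinear.tangentAction_eq {w : OrbifoldChart n X}
    {ρ : w.Γ →* (EuclideanSpace ℝ (Fin n) →L[ℝ] EuclideanSpace ℝ (Fin n))} (hw : w.IsLinear ρ)
    (p : w.domain) (γ : w.Γ) : w.tangentAction p γ = ρ γ :=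
  (w.smoothOpens_smul γ).opensDeriv_eq (ρ γ).hasFDerivAt
    (Eventually.of_forall fun v => hw.coe_smul γ v)

/-- The centre of a linear chart. -/
def IsLinear.center {w : OrbifoldChart n X}
    {ρ : w.Γ →* (EuclideanSpace ℝ (Fin n) →L[ℝ] EuclideanSpace ℝ (Fin n))} (hw : w.IsLinear ρ) :
    w.domain := ⟨0, hw.zero_mem⟩

theorem IsLinear.smul_center {w : OrbifoldChart n X}
    {ρ : w.Γ →* (EuclideanSpace ℝ (Fin n) →L[ℝ] EuclideanSpace ℝ (Fin n))} (hw : w.IsLinear ρ)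
    (γ : w.Γ) : γ • hw.center = hw.center := by
  apply Subtype.ext
  rw [hw.coe_smul]
  exact map_zero _

theorem IsLinear.mem_fixedTangent_center {w : OrbifoldChart n X}
    {ρ : w.Γ →* (EuclideanSpace ℝ (Fin n) →L[ℝ] EuclideanSpace ℝ (Fin n))} (hw : w.IsLinear ρ)
    {v : EuclideanSpace ℝ (Fin n)} : v ∈ w.fixedTangent hw.center ↔ ∀ γ, ρ γ v = v := by
  refine forall_congr' fun γ => ?_
  rw [hw.tangentAction_eq]
  exact ⟨fun h => h (hw.smul_center γ), fun h _ => h⟩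

/-- Around each point of a chart there is a small linear chart. -/
theorem exists_isLinear_isEmbedding (c : OrbifoldChart n X) (q : c.domain) {N : Set c.domain}
    (hN : N ∈ 𝓝 q) :
    ∃ (w : OrbifoldChart n X)
      (ρ : w.Γ →* (EuclideanSpace ℝ (Fin n) →L[ℝ] EuclideanSpace ℝ (Fin n)))
      (hw : w.IsLinear ρ) (κ : w.domain → c.domain), IsEmbedding w c κ ∧ κ hw.center = q ∧
      range κ ⊆ N ∧ w.fixedTangent hw.center = c.fixedTangent q := by
  -- Inside `N₁` only elements of the stabilizer of `q` identify points, so the quotient by the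
  -- stabilizer still injects into `X`.
  obtain ⟨N₁, hN₁, hdisj⟩ : ∃ N₁ ∈ 𝓝 q, ∀ γ : c.Γ, ∀ u ∈ N₁, γ • u ∈ N₁ → γ • q = q := by
    have : ∀ γ : c.Γ, ∃ M ∈ 𝓝 q, ∀ u ∈ M, γ • u ∈ M → γ • q = q := by
      intro γ
      by_cases hγ : γ • q = q
      · exact ⟨univ, univ_mem, fun _ _ _ => hγ⟩
      · obtain ⟨A, B, hA, hB, hAB⟩ := t2_separation_nhds hγ
        refine ⟨B ∩ (fun u => γ • u) ⁻¹' A, inter_mem hB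
          ((continuous_const_smul γ).continuousAt.preimage_mem_nhds hA), fun u hu hγu => ?_⟩
        exact (hAB.le_bot ⟨hu.2, hγu.1⟩).elim
    choose M hM hM' using this
    exact ⟨⋂ γ, M γ, iInter_mem.2 hM, fun γ u hu hγu =>
      hM' γ u (mem_iInter.1 hu γ) (mem_iInter.1 hγu γ)⟩
  obtain ⟨B, h0, κ, hBc, hκ0, hκs, hκi, hκo, hκN, hκ⟩ := exists_linear_model
    (G := MulAction.stabilizer c.Γ q) (fun γ => c.smoothOpens_smul (γ : c.Γ)) q
    (fun γ => γ.2) (inter_mem hN hN₁)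
  let ρ := c.stabilizerRep q
  have hρB : ∀ γ, ∀ v : B, ρ γ v ∈ B := fun γ v => (hκ γ v).1
  have hκρ : ∀ γ (v : B), κ ⟨ρ γ v, hρB γ v⟩ = γ • κ v := fun γ v => (hκ γ v).2
  let act : MulAction (MulAction.stabilizer c.Γ q) B :=
    { smul := fun γ v => ⟨ρ γ v, hρB γ v⟩
      one_smul := fun v => Subtype.ext (by
        change ρ 1 v = v
        rw [map_one]; rfl)
      mul_smul := fun γ δ v => Subtype.ext (by
        change ρ (γ * δ) v = ρ γ (ρ δ v)
        rw [map_mul]; rfl) }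
  have hκsmul : ∀ (γ : MulAction.stabilizer c.Γ q) (v : B), κ (γ • v) = (γ : c.Γ) • κ v := hκρ
  have hsm : ∀ γ : MulAction.stabilizer c.Γ q, SmoothOpens fun v : B => γ • v := by
    intro γ
    rw [SmoothOpens, ← ContMDiff.subtypeVal_comp_iff]
    exact (ρ γ).contDiff.contMDiff.comp contMDiff_subtype_val
  have hcs : ContinuousConstSMul (MulAction.stabilizer c.Γ q) B :=
    ⟨fun γ => (hsm γ).continuous⟩
  have hfaith : FaithfulSMul (MulAction.stabilizer c.Γ q) B := by
    have key : ∀ γ : MulAction.stabilizer c.Γ q, (∀ v : B, γ • v = v) → γ = 1 := by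
      intro γ hγ
      apply Subtype.ext
      refine c.eq_one_of_eventually_smul_eq γ q ?_
      have : range κ ∈ 𝓝 q := hκo.isOpen_range.mem_nhds ⟨_, hκ0⟩
      filter_upwards [this]
      rintro _ ⟨v, rfl⟩
      rw [← hκsmul, hγ]
    refine ⟨fun {γ δ} h => ?_⟩
    have := key (δ⁻¹ * γ) fun v => by rw [mul_smul, h, inv_smul_smul]
    exact (inv_mul_eq_one.1 this).symm
  have hfib : ∀ v v' : B, c.proj (κ v) = c.proj (κ v') →
      ∃ γ : MulAction.stabilizer c.Γ q, γ • v = v' := by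
    intro v v' h
    obtain ⟨γ, hγ⟩ := c.proj_eq_iff.1 h
    have hq : γ • q = q := hdisj γ (κ v) (hκN ⟨v, rfl⟩).2 (hγ ▸ (hκN ⟨v', rfl⟩).2)
    exact ⟨⟨γ, hq⟩, hκo.injective ((hκsmul ⟨γ, hq⟩ v).trans hγ)⟩
  have hproj : Continuous (c.proj ∘ κ) := c.continuous_proj.comp hκs.continuous
  let w : OrbifoldChart n X :=
    { domain := B
      isConnected_domain := ⟨⟨0, h0⟩, hBc.isPreconnected⟩
      Γ := MulAction.stabilizer c.Γ q
      smooth_smul := hsm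
      proj := c.proj ∘ κ
      continuous_proj := hproj
      proj_smul := fun γ v => by
        rw [Function.comp_apply, hκsmul, c.proj_smul]; rfl
      isOpenEmbedding_quotient := by
        refine .of_continuous_injective_isOpenMap (hproj.quotient_lift _) ?_ ?_
        · rintro ⟨v⟩ ⟨v'⟩ h
          obtain ⟨γ, hγ⟩ := hfib v v' h
          exact Quotient.sound (MulAction.orbitRel_apply.2
            ⟨γ⁻¹, by rw [← hγ]; exact inv_smul_smul _ _⟩)
        · intro s hs
          have := (c.isOpenMap_proj.comp hκo.isOpenMap) _ (hs.preimage continuous_quotient_mk')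
          convert this using 1
          conv_lhs => rw [← image_preimage_eq s Quotient.mk_surjective, ← image_comp]
          rfl }
  have hw : w.IsLinear ρ := ⟨h0, fun γ v => rfl⟩
  refine ⟨w, ρ, hw, κ, ⟨hκs, hκi, hκo.isEmbedding, rfl⟩, hκ0, hκN.trans inter_subset_left, ?_⟩
  ext v
  rw [hw.mem_fixedTangent_center]
  exact Subtype.forall
end OrbifoldChart

/-! ### Invariance of the fixed space dimension under embeddings -/

namespace OrbifoldChart

open TopologicalSpace Filter Module

variable {n : ℕ} {X : Type*} [TopologicalSpace X]

theorem finrank_le_of_injective_of_forall_mem {E F : Type*} [NormedAddCommGroup E]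
    [NormedSpace ℝ E] [NormedAddCommGroup F] [NormedSpace ℝ F] [FiniteDimensional ℝ F]
    {A : E →L[ℝ] F} (hA : Function.Injective A) {S : Submodule ℝ E} {T : Submodule ℝ F}
    (h : ∀ v ∈ S, A v ∈ T) : finrank ℝ S ≤ finrank ℝ T := by
  rw [(Submodule.equivMapOfInjective A.toLinearMap hA S).finrank_eq]
  refine Submodule.finrank_mono ?_
  rintro _ ⟨v, hv, rfl⟩
  exact h v hv

/-- No homomorphism of isotropy groups is needed. Points `u = t • v` are fixed by all of `a.Γ`. For
small `t`, `γ • e u` is some `e u'` over the same point of `X`, so `u'` is in the orbit of `u` and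
equals `u`. Thus `γ` fixes the curve `e (t • v)`, hence its velocity at `0`. -/
theorem IsLinear.opensDeriv_mem_fixedTangent {a c : OrbifoldChart n X}
    {ρ : a.Γ →* (EuclideanSpace ℝ (Fin n) →L[ℝ] EuclideanSpace ℝ (Fin n))} (ha : a.IsLinear ρ)
    {e : a.domain → c.domain} (he : IsEmbedding a c e) {v : EuclideanSpace ℝ (Fin n)}
    (hv : v ∈ a.fixedTangent ha.center) :
    opensDeriv e ha.center v ∈ c.fixedTangent (e ha.center) := by
  rw [ha.mem_fixedTangent_center] at hv
  intro γ hγ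
  rw [MulAction.mem_stabilizer_iff] at hγ
  set g := zeroExtend (Subtype.val ∘ e) with hg
  set k := zeroExtend (Subtype.val ∘ fun q : c.domain => γ • q) with hk
  have hline : HasDerivAt (fun t : ℝ => t • v) v 0 := by
    simpa using (hasDerivAt_id (0 : ℝ)).smul_const v
  have hz : (0 : ℝ) • v = (ha.center : EuclideanSpace ℝ (Fin n)) := zero_smul _ _
  have h1 : HasDerivAt (fun t : ℝ => g (t • v)) (opensDeriv e ha.center v) 0 := by
    have h := he.smoothOpens.hasFDerivAt ha.center
    rw [← hz] at h
    exact h.comp_hasDerivAt (0 : ℝ) hline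
  have h2 : HasDerivAt (fun t : ℝ => k (g (t • v)))
      (c.tangentAction (e ha.center) γ (opensDeriv e ha.center v)) 0 := by
    have h := (c.smoothOpens_smul γ).hasFDerivAt (e ha.center)
    have h0 : g ((0 : ℝ) • v) = e ha.center := by rw [hz, hg, zeroExtend_coe]; rfl
    rw [← h0] at h
    exact h.comp_hasDerivAt (0 : ℝ) h1
  refine h2.unique (h1.congr_of_eventuallyEq ?_)
  have hnear : ∀ᶠ u : a.domain in 𝓝 ha.center, γ • e u ∈ range e := by
    have hc : ContinuousAt (fun u : a.domain => γ • e u) ha.center :=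
      ((continuous_const_smul γ).comp he.smooth.continuous).continuousAt
    refine hc.eventually (he.isOpenMap.isOpen_range.mem_nhds ?_)
    change γ • e ha.center ∈ range e
    rw [hγ]
    exact mem_range_self _
  have hnear' : ∀ᶠ z in 𝓝 ((0 : ℝ) • v), ∃ u : a.domain, (u : EuclideanSpace ℝ (Fin n)) = z ∧
      γ • e u ∈ range e := by
    rw [hz, ← a.domain.isOpenEmbedding'.map_nhds_eq, eventually_map]
    filter_upwards [hnear] with u hu using ⟨u, rfl, hu⟩
  filter_upwards [hline.continuousAt.eventually hnear'] with t ht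
  obtain ⟨u, hu, u', hu'⟩ := ht
  have hp : a.proj u = a.proj u' := by
    rw [← he.proj_apply, ← he.proj_apply, hu', c.proj_smul]
  obtain ⟨δ, hδ⟩ := a.proj_eq_iff.1 hp
  have : δ • u = u := by
    apply Subtype.ext
    rw [ha.coe_smul, hu, map_smul, hv]
  rw [this] at hδ
  rw [← hu, hk, hg, zeroExtend_coe, Function.comp_apply, zeroExtend_coe, Function.comp_apply,
    ← hu', hδ]

theorem IsLinear.finrank_fixedTangent_le {a c : OrbifoldChart n X}
    {ρ : a.Γ →* (EuclideanSpace ℝ (Fin n) →L[ℝ] EuclideanSpace ℝ (Fin n))} (ha : a.IsLinear ρ)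
    {e : a.domain → c.domain} (he : IsEmbedding a c e) :
    finrank ℝ (a.fixedTangent ha.center) ≤ finrank ℝ (c.fixedTangent (e ha.center)) := by
  exact finrank_le_of_injective_of_forall_mem (he.opensDeriv_injective ha.center)
    fun v hv => ha.opensDeriv_mem_fixedTangent he hv

/-- One inequality comes from a linear chart at `r` pushed into `d`, the other from a linear chart
at `l r` so small that it factors through `l`. -/
theorem IsEmbedding.finrank_fixedTangent {c d : OrbifoldChart n X} {l : c.domain → d.domain}
    (hl : IsEmbedding c d l) (r : c.domain) :
    finrank ℝ (c.fixedTangent r) = finrank ℝ (d.fixedTangent (l r)) := by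
  apply le_antisymm
  · obtain ⟨a, ρ, ha, κ, hκ, hκ0, -, hfix⟩ := c.exists_isLinear_isEmbedding r univ_mem
    have h := ha.finrank_fixedTangent_le (hl.comp hκ)
    rwa [Function.comp_apply, hκ0, hfix] at h
  · obtain ⟨a, ρ, ha, κ, hκ, hκ0, hr, hfix⟩ := d.exists_isLinear_isEmbedding (l r)
      (hl.isOpenMap.isOpen_range.mem_nhds (mem_range_self r))
    obtain ⟨m, hm, hlm⟩ := hl.exists_lift hκ hr
    have : m ha.center = r := hl.isEmbedding.injective ((congrFun hlm _).trans hκ0)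
    rw [← hfix, ← this]
    exact ha.finrank_fixedTangent_le hm

theorem finrank_fixedTangent_eq_of_proj_eq (c : OrbifoldChart n X) {p q : c.domain}
    (h : c.proj p = c.proj q) :
    finrank ℝ (c.fixedTangent p) = finrank ℝ (c.fixedTangent q) := by
  obtain ⟨γ, rfl⟩ := c.proj_eq_iff.1 h
  exact (c.isEmbedding_smul γ).finrank_fixedTangent p

end OrbifoldChart

/-! ### The singular dimension and the maximal atlas -/

namespace Orbifold

open TopologicalSpace Filter Module OrbifoldChart

variable {n : ℕ} {X : Type*} [TopologicalSpace X]

theorem finrank_fixedTangent_eq (O : Orbifold n X) {c d : OrbifoldChart n X} (hc : c ∈ O.atlas)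
    (hd : d ∈ O.atlas) {p : c.domain} {q : d.domain} (h : c.proj p = d.proj q) :
    finrank ℝ (c.fixedTangent p) = finrank ℝ (d.fixedTangent q) := by
  obtain ⟨w, ⟨r, hr⟩, -, ⟨l, hl⟩, ⟨k, hk⟩⟩ := O.compatible c hc d hd (c.proj p)
    ⟨c.mem_image p, h ▸ d.mem_image q⟩
  rw [c.finrank_fixedTangent_eq_of_proj_eq (q := l r) (by rw [hl.proj_apply, hr]),
    d.finrank_fixedTangent_eq_of_proj_eq (p := q) (q := k r) (by rw [hk.proj_apply, hr, h]),
    ← hl.finrank_fixedTangent, ← hk.finrank_fixedTangent]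

theorem sdim_proj (O : Orbifold n X) {c : OrbifoldChart n X} (hc : c ∈ O.atlas) (p : c.domain) :
    O.sdim (c.proj p) = finrank ℝ (c.fixedTangent p) :=
  O.finrank_fixedTangent_eq (O.exists_lift (c.proj p)).choose_spec.1 hc
    (O.exists_lift (c.proj p)).choose_spec.2

/-- By maximality it suffices that `w` is compatible with each `e` in the atlas: a chart witnessing
this for `d` and `e` can be shrunk until it factors through `w`. -/
theorem mem_atlas_of_embeds (O : Orbifold n X) {w d : OrbifoldChart n X} (hd : d ∈ O.atlas)
    (h : w.Embeds d) : w ∈ O.atlas := by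
  obtain ⟨l, hl⟩ := h
  refine O.maximal w fun e he => ?_
  rintro _ ⟨⟨r, rfl⟩, hre⟩
  obtain ⟨a, ⟨s, hs⟩, -, ⟨k, hk⟩, ⟨m, hm⟩⟩ := O.compatible d hd e he (w.proj r)
    ⟨hl.image_subset (w.mem_image r), hre⟩
  have hproj : d.proj (k s) = d.proj (l r) := by rw [hk.proj_apply, hl.proj_apply, hs]
  -- The embedding `k` may hit another lift of the point; composing with `γ` moves it to `l r`,
  -- inside the range of `l`.
  obtain ⟨γ, hγ⟩ := d.proj_eq_iff.1 hproj
  have hk' := (d.isEmbedding_smul γ).comp hk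
  have hN : ((fun p : d.domain => γ • p) ∘ k) ⁻¹' range l ∈ 𝓝 s := by
    refine hk'.smooth.continuous.continuousAt.preimage_mem_nhds
      (hl.isOpenMap.isOpen_range.mem_nhds ?_)
    rw [Function.comp_apply, hγ]
    exact mem_range_self r
  obtain ⟨b, ρ, hb, κ, hκ, hκ0, hr, -⟩ := a.exists_isLinear_isEmbedding s hN
  obtain ⟨j, hj, -⟩ := hl.exists_lift (hk'.comp hκ) (by
    rintro _ ⟨p, rfl⟩
    exact hr (mem_range_self p))
  refine ⟨b, ?_, subset_inter hj.image_subset (hm.comp hκ).image_subset, ⟨j, hj⟩, _, hm.comp hκ⟩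
  rw [← hs, ← hκ0, hκ.proj_apply]
  exact b.mem_image _

/-- Every point is the centre of arbitrarily small linear charts of the atlas. -/
theorem exists_isLinear_mem_atlas (O : Orbifold n X) (x : X) {U : Set X} (hU : U ∈ 𝓝 x) :
    ∃ w ∈ O.atlas,
      ∃ (ρ : w.Γ →* (EuclideanSpace ℝ (Fin n) →L[ℝ] EuclideanSpace ℝ (Fin n)))
        (hw : w.IsLinear ρ), w.proj hw.center = x ∧ w.image ⊆ U := by
  obtain ⟨c, hc, p, rfl⟩ := O.covers x
  obtain ⟨w, ρ, hw, κ, hκ, hκ0, hr, -⟩ := c.exists_isLinear_isEmbedding p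
    (c.continuous_proj.continuousAt.preimage_mem_nhds hU)
  refine ⟨w, O.mem_atlas_of_embeds hc ⟨κ, hκ⟩, ρ, hw, ?_, ?_⟩
  · rw [← hκ.proj_apply, hκ0]
  · rintro _ ⟨v, rfl⟩
    rw [← hκ.proj_apply]
    exact hr (mem_range_self v)

end Orbifold

/-! ### Descending equivariant maps from a chart to the orbifold -/

namespace Orbifold

open TopologicalSpace Filter OrbifoldChart

variable {m n : ℕ} {X Y : Type*} [TopologicalSpace X] [TopologicalSpace Y]

/-- A map with local smooth lifts on `O × [0,1]` is a smooth homotopy: continuity is automatic. -/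
theorem isSmoothHomotopy_of_lifts {O : Orbifold m X} {P : Orbifold n Y} {F : X × unitInterval → Y}
    (h : ∀ (x : X) (t : unitInterval),
      ∃ c ∈ O.atlas, ∃ J : TopologicalSpace.Opens unitInterval, ∃ d ∈ P.atlas,
        x ∈ c.image ∧ t ∈ J ∧ IsConnected (J : Set unitInterval) ∧ F (x, t) ∈ d.image ∧
        ∃ G : c.domain × J → d.domain,
          ContMDiff (𝓘(ℝ, EuclideanSpace ℝ (Fin m)).prod (𝓡∂ 1))
            𝓘(ℝ, EuclideanSpace ℝ (Fin n)) ∞ G ∧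
          ∀ (p : c.domain) (s : J), d.proj (G (p, s)) = F (c.proj p, s)) :
    IsSmoothHomotopy O P F := by
  refine ⟨continuous_iff_continuousAt.2 ?_, h⟩
  rintro ⟨x, t⟩
  obtain ⟨c, -, J, d, -, ⟨p, rfl⟩, htJ, -, -, G, hG, hGF⟩ := h x t
  -- Chart projections are open, so continuity can be tested upstairs on the lift.
  have hmap : map (Prod.map c.proj (Subtype.val : J → unitInterval)) (𝓝 (p, ⟨t, htJ⟩)) =
      𝓝 (c.proj p, t) := by
    rw [nhds_prod_eq, nhds_prod_eq, ← prod_map_map_eq', c.map_nhds_proj,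
      J.isOpenEmbedding'.map_nhds_eq]
  rw [ContinuousAt, ← hmap, tendsto_map'_iff]
  have hcont : Continuous (d.proj ∘ G) := d.continuous_proj.comp hG.continuous
  have e : F ∘ Prod.map c.proj (Subtype.val : J → unitInterval) = d.proj ∘ G := by
    funext ⟨q, s⟩
    exact (hGF q s).symm
  rw [e]
  have := hcont.tendsto (p, ⟨t, htJ⟩)
  rwa [Function.comp_apply, hGF] at this

theorem IsSmoothHomotopy.isSmoothMap {O : Orbifold m X} {P : Orbifold n Y}
    {F : X × unitInterval → Y} (h : IsSmoothHomotopy O P F) (t : unitInterval) :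
    IsSmoothMap O P fun x => F (x, t) := by
  refine ⟨h.1.comp (by fun_prop), fun x => ?_⟩
  obtain ⟨c, hc, J, d, hd, hx, htJ, -, hFx, G, hG, hGF⟩ := h.2 x t
  exact ⟨c, hc, d, hd, hx, hFx, fun p => G (p, ⟨t, htJ⟩),
    hG.comp (contMDiff_id.prodMk contMDiff_const), fun p => hGF p _⟩

open Classical in
/-- The self-map of `X` that is induced on the image of a chart by an equivariant self-map of its
domain, and is the identity elsewhere. -/
noncomputable def descend (w : OrbifoldChart n X) (Ψ : w.domain → w.domain) (z : X) : X :=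
  if h : z ∈ w.image then w.proj (Ψ h.choose) else z

theorem descend_proj {w : OrbifoldChart n X} {Ψ : w.domain → w.domain}
    (heq : ∀ (γ : w.Γ) p, Ψ (γ • p) = γ • Ψ p) (p : w.domain) :
    descend w Ψ (w.proj p) = w.proj (Ψ p) := by
  have h := w.mem_image p
  rw [descend, dif_pos h]
  obtain ⟨γ, hγ⟩ := w.proj_eq_iff.1 (Exists.choose_spec h)
  conv_rhs => rw [← hγ, heq, w.proj_smul]

theorem descend_of_notMem {w : OrbifoldChart n X} {Ψ : w.domain → w.domain} {K : Set w.domain}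
    (heq : ∀ (γ : w.Γ) p, Ψ (γ • p) = γ • Ψ p) (hid : ∀ p ∉ K, Ψ p = p) {z : X}
    (hz : z ∉ w.proj '' K) : descend w Ψ z = z := by
  by_cases h : z ∈ w.image
  · obtain ⟨p, rfl⟩ := h
    rw [descend_proj heq, hid p fun hp => hz ⟨p, hp, rfl⟩]
  · rw [descend, dif_neg h]

theorem descend_comp {w : OrbifoldChart n X} {Ψ Θ : w.domain → w.domain}
    (hΨ : ∀ (γ : w.Γ) p, Ψ (γ • p) = γ • Ψ p) (hΘ : ∀ (γ : w.Γ) p, Θ (γ • p) = γ • Θ p)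
    (h : ∀ p, Ψ (Θ p) = p) : descend w Ψ ∘ descend w Θ = id := by
  funext z
  rw [Function.comp_apply, id]
  by_cases hz : z ∈ w.image
  · obtain ⟨p, rfl⟩ := hz
    rw [descend_proj hΘ, descend_proj hΨ, h]
  · have e : ∀ Ξ : w.domain → w.domain, descend w Ξ z = z := fun Ξ => dif_neg hz
    rw [e, e]

/-- Hausdorffness of `X` enters here; it lets the extension by the identity be smooth at the
frontier of the chart's image. -/
theorem isClosed_proj_image (O : Orbifold n X) {w : OrbifoldChart n X} {K : Set w.domain}
    (hK : IsCompact K) : IsClosed (w.proj '' K) := by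
  have := O.t2Space
  exact (hK.image w.continuous_proj).isClosed

/-- An equivariant smooth family of self-maps of the domain of a chart that is the identity
outside a compact set induces a smooth homotopy. -/
theorem isSmoothHomotopy_descend (O : Orbifold n X) {w : OrbifoldChart n X} (hw : w ∈ O.atlas)
    {Ψ : unitInterval → w.domain → w.domain} {K : Set w.domain} (hK : IsCompact K)
    (hΨ : ContMDiff (𝓘(ℝ, EuclideanSpace ℝ (Fin n)).prod (𝓡∂ 1))
      𝓘(ℝ, EuclideanSpace ℝ (Fin n)) ∞ fun q : w.domain × unitInterval => Ψ q.2 q.1)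
    (heq : ∀ t (γ : w.Γ) p, Ψ t (γ • p) = γ • Ψ t p) (hid : ∀ t, ∀ p ∉ K, Ψ t p = p) :
    IsSmoothHomotopy O O fun z => descend w (Ψ z.2) z.1 := by
  refine isSmoothHomotopy_of_lifts fun x t => ?_
  have htop : IsConnected ((⊤ : Opens unitInterval) : Set unitInterval) := isConnected_univ
  by_cases hx : x ∈ w.image
  · refine ⟨w, hw, ⊤, w, hw, hx, mem_univ t, htop, ?_, fun q => Ψ q.2 q.1, ?_, ?_⟩
    · obtain ⟨p, rfl⟩ := hx
      change descend w (Ψ t) (w.proj p) ∈ _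
      rw [descend_proj (heq t)]
      exact w.mem_image _
    · exact hΨ.comp (contMDiff_fst.prodMk (contMDiff_subtype_val.comp contMDiff_snd))
    · exact fun p s => (descend_proj (heq s) p).symm
  -- A chart around `x` that avoids the image of `K` sees only the identity, whose lift is the first
  -- projection.
  · have hxK : x ∉ w.proj '' K := fun ⟨p, _, hp⟩ => hx ⟨p, hp⟩
    obtain ⟨e, he, _, _, hex, heK⟩ := O.exists_isLinear_mem_atlas x
      ((O.isClosed_proj_image hK).isOpen_compl.mem_nhds hxK)
    have hxe : x ∈ e.image := hex ▸ e.mem_image _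
    refine ⟨e, he, ⊤, e, he, hxe, mem_univ t, htop, ?_, Prod.fst, contMDiff_fst, ?_⟩
    · change descend w (Ψ t) x ∈ _
      rwa [descend_of_notMem (heq t) (hid t) hxK]
    · exact fun p s => (descend_of_notMem (heq s) (hid s) (heK (e.mem_image p))).symm

theorem isSmoothMap_descend (O : Orbifold n X) {w : OrbifoldChart n X} (hw : w ∈ O.atlas)
    {Ψ : w.domain → w.domain} {K : Set w.domain} (hK : IsCompact K) (hΨ : SmoothOpens Ψ)
    (heq : ∀ (γ : w.Γ) p, Ψ (γ • p) = γ • Ψ p) (hid : ∀ p ∉ K, Ψ p = p) :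
    IsSmoothMap O O (descend w Ψ) :=
  (O.isSmoothHomotopy_descend hw (Ψ := fun _ => Ψ) hK (ContMDiff.comp hΨ contMDiff_fst)
    (fun _ => heq) fun _ => hid).isSmoothMap 0

theorem isIsotopy_descend (O : Orbifold n X) {w : OrbifoldChart n X} (hw : w ∈ O.atlas)
    {Ψ Θ : unitInterval → w.domain → w.domain} {K : Set w.domain} (hK : IsCompact K)
    (hΨ : ContMDiff (𝓘(ℝ, EuclideanSpace ℝ (Fin n)).prod (𝓡∂ 1))
      𝓘(ℝ, EuclideanSpace ℝ (Fin n)) ∞ fun q : w.domain × unitInterval => Ψ q.2 q.1)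
    (heq : ∀ t (γ : w.Γ) p, Ψ t (γ • p) = γ • Ψ t p) (hid : ∀ t, ∀ p ∉ K, Ψ t p = p)
    (hΘ : ∀ t, SmoothOpens (Θ t)) (hl : ∀ t p, Θ t (Ψ t p) = p) (hr : ∀ t p, Ψ t (Θ t p) = p)
    (h0 : ∀ p, Ψ 0 p = p) :
    IsIsotopy O O id (descend w (Ψ 1)) fun z => descend w (Ψ z.2) z.1 := by
  have hH := O.isSmoothHomotopy_descend hw hK hΨ heq hid
  refine ⟨hH, fun t => ⟨hH.isSmoothMap t, descend w (Θ t), ?_, ?_, ?_⟩, fun x => ?_, fun x => rfl⟩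
  all_goals
    -- The inverse of an equivariant bijection is equivariant.
    have heq' : ∀ t (γ : w.Γ) p, Θ t (γ • p) = γ • Θ t p := fun t γ p => by
      conv_lhs => rw [← hr t p, ← heq, hl]
  · refine O.isSmoothMap_descend hw hK (hΘ t) (heq' t) fun p hp => ?_
    conv_lhs => rw [← hid t p hp, hl]
  · exact descend_comp (heq' t) (heq t) (hl t)
  · exact descend_comp (heq t) (heq' t) (hr t)
  · exact descend_of_notMem (K := ∅) (heq 0) (fun p _ => h0 p) (by simp)

theorem isotopySupp_descend_subset (O : Orbifold n X) {w : OrbifoldChart n X}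
    {Ψ : unitInterval → w.domain → w.domain} {K : Set w.domain} (hK : IsCompact K)
    (heq : ∀ t (γ : w.Γ) p, Ψ t (γ • p) = γ • Ψ t p) (hid : ∀ t, ∀ p ∉ K, Ψ t p = p) :
    isotopySupp (fun z : X × unitInterval => descend w (Ψ z.2) z.1) ⊆ w.proj '' K := by
  refine closure_minimal ?_ (O.isClosed_proj_image hK)
  rintro z ⟨t, ht⟩
  by_contra hz
  exact ht (descend_of_notMem (heq t) (hid t) hz)

end Orbifold

/-! ### Cut-off translations and invariant bump functions -/

section Push

variable {E : Type*} [NormedAddCommGroup E] [NormedSpace ℝ E] [FiniteDimensional ℝ E]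

/-- Translations that are cut off by a function of small Lipschitz constant are
diffeomorphisms. -/
theorem exists_homeomorph_add_smul {χ : E → ℝ} {L : NNReal} (hχ : ContDiff ℝ ∞ χ)
    (hL : LipschitzWith L χ) {v₁ : E} (hv : L * ‖v₁‖ < 1) :
    ∃ h : E ≃ₜ E, (∀ v, h v = v + χ v • v₁) ∧ ContDiff ℝ ∞ h.symm := by
  have : CompleteSpace E := FiniteDimensional.complete ℝ E
  set f : E → E := fun v => v + χ v • v₁ with hf
  have happ : ApproximatesLinearOn f (ContinuousLinearEquiv.refl ℝ E : E →L[ℝ] E) univ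
      (L * ‖v₁‖₊) := by
    rw [ApproximatesLinearOn.approximatesLinearOn_iff_lipschitzOnWith, lipschitzOnWith_univ]
    refine LipschitzWith.of_dist_le_mul fun v w => ?_
    have e : ∀ v, (f - ((ContinuousLinearEquiv.refl ℝ E : E →L[ℝ] E) : E → E)) v = χ v • v₁ := by
      intro v
      simp [hf]
    rw [e, e, dist_eq_norm, ← sub_smul, norm_smul, ← dist_eq_norm]
    have := hL.dist_le_mul v w
    calc dist (χ v) (χ w) * ‖v₁‖ ≤ L * dist v w * ‖v₁‖ := by gcongr
      _ = _ := by push_cast; ring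
  -- The trivial space is separate because its identity map has norm `0`, not `1`.
  have hlt : Subsingleton E ∨
      L * ‖v₁‖₊ < ‖((ContinuousLinearEquiv.refl ℝ E).symm : E →L[ℝ] E)‖₊⁻¹ := by
    rcases subsingleton_or_nontrivial E with h | h
    · exact .inl h
    · right
      have : ‖((ContinuousLinearEquiv.refl ℝ E).symm : E →L[ℝ] E)‖₊ = 1 :=
        ContinuousLinearMap.nnnorm_id
      rw [this, inv_one]
      exact_mod_cast hv
  have hfs : ContDiff ℝ ∞ f := contDiff_id.add (hχ.smul contDiff_const)
  have hd : ∀ a, ∃ A : E ≃L[ℝ] E, HasFDerivAt f (A : E →L[ℝ] E) a := by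
    intro a
    have hfa := (hfs.differentiable (by simp) a).hasFDerivAt
    obtain ⟨A, hA⟩ := exists_equiv_of_injective (A := fderiv ℝ f a) (by
      have h1 : HasFDerivAt f (.id ℝ E + (fderiv ℝ χ a).smulRight v₁) a :=
        (hasFDerivAt_id a).add ((hχ.differentiable (by simp) a).hasFDerivAt.smul_const v₁)
      rw [h1.fderiv]
      refine (injective_iff_map_eq_zero _).2 fun w hw => ?_
      have hw' : w + fderiv ℝ χ a w • v₁ = 0 := hw
      have hle : ‖w‖ ≤ L * ‖v₁‖ * ‖w‖ := by
        calc ‖w‖ = ‖fderiv ℝ χ a w • v₁‖ := by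
              rw [← norm_neg, neg_eq_of_add_eq_zero_right hw']
          _ = ‖fderiv ℝ χ a w‖ * ‖v₁‖ := norm_smul _ _
          _ ≤ L * ‖w‖ * ‖v₁‖ := by
              gcongr
              exact (fderiv ℝ χ a).le_of_opNorm_le (norm_fderiv_le_of_lipschitz ℝ hL) w
          _ = _ := by ring
      by_contra h
      have : 0 < ‖w‖ := norm_pos_iff.2 h
      nlinarith)
    exact ⟨A, hA ▸ hfa⟩
  choose A hA using hd
  exact ⟨happ.toHomeomorph f hlt, fun v => rfl,
    (happ.toHomeomorph f hlt).contDiff_symm (f₀' := A) hA hfs⟩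

/-- A smooth bump function at `0` that is invariant under a finite linear group and is supported
in an invariant neighbourhood of `0`. -/
theorem exists_invariant_bump {G : Type*} [Group G] [Finite G] (ρ : G →* (E →L[ℝ] E)) {B : Set E}
    (hB : B ∈ 𝓝 0) (hρ : ∀ γ, ∀ v ∈ B, ρ γ v ∈ B) :
    ∃ (χ : E → ℝ) (K : Set E), ContDiff ℝ ∞ χ ∧ IsCompact K ∧ K ⊆ B ∧ (∀ v ∉ K, χ v = 0) ∧
      χ 0 = 1 ∧ ∀ γ v, χ (ρ γ v) = χ v := by
  cases nonempty_fintype G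
  obtain ⟨χ, hsub, hcomp, hsm, -, h1⟩ := exists_contDiff_tsupport_subset (n := ⊤) hB
  -- Averaging gives invariance and keeps the value `1` at `0`; the translates of the support stay
  -- in the invariant set `B`.
  refine ⟨fun v => (Fintype.card G : ℝ)⁻¹ * ∑ γ : G, χ (ρ γ v), ⋃ γ, ρ γ '' tsupport χ, ?_, ?_, ?_,
    ?_, ?_, ?_⟩
  · exact contDiff_const.mul (ContDiff.sum fun γ _ => hsm.comp (ρ γ).contDiff)
  · exact isCompact_iUnion fun γ => hcomp.isCompact.image (ρ γ).continuous
  · refine iUnion_subset fun γ => ?_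
    rintro _ ⟨v, hv, rfl⟩
    exact hρ γ v (hsub hv)
  · intro v hv
    refine mul_eq_zero_of_right _ (Finset.sum_eq_zero fun γ _ => ?_)
    refine image_eq_zero_of_notMem_tsupport fun hγ => hv (mem_iUnion.2 ⟨γ⁻¹, _, hγ, ?_⟩)
    rw [MonoidHom.clm_apply_apply, inv_mul_cancel, map_one]
    rfl
  · simp [h1]
  · intro γ v
    simp only [MonoidHom.clm_apply_apply]
    congr 1
    exact Fintype.sum_equiv (Equiv.mulRight γ) _ _ fun δ => rfl

end Push

/-! ### Strata in linear charts and the pushing isotopy -/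

namespace Orbifold

open TopologicalSpace Filter OrbifoldChart

variable {n : ℕ} {X : Type*} [TopologicalSpace X]

/-- A point of a linear chart with the singular dimension of the centre is fixed by the group. -/
theorem rep_apply_eq_of_sdim_eq (O : Orbifold n X) {w : OrbifoldChart n X} (hw : w ∈ O.atlas)
    {ρ : w.Γ →* (EuclideanSpace ℝ (Fin n) →L[ℝ] EuclideanSpace ℝ (Fin n))} (hρ : w.IsLinear ρ)
    {v : w.domain} (h : O.sdim (w.proj v) = O.sdim (w.proj hρ.center)) (γ : w.Γ) :
    ρ γ v = v := by
  rw [O.sdim_proj hw, O.sdim_proj hw] at h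
  have hle : w.fixedTangent hρ.center ≤ w.fixedTangent v := by
    intro u hu δ _
    rw [hρ.tangentAction_eq]
    exact hρ.mem_fixedTangent_center.1 hu δ
  have heq := Submodule.eq_of_le_of_finrank_eq hle h.symm
  -- In a linear chart `v` is also a tangent vector at itself, fixed by its own stabilizer.
  have hv : (v : EuclideanSpace ℝ (Fin n)) ∈ w.fixedTangent v := by
    intro δ hδ
    rw [hρ.tangentAction_eq, ← hρ.coe_smul, MulAction.mem_stabilizer_iff.1 hδ]
  rw [← heq] at hv
  exact hρ.mem_fixedTangent_center.1 hv γ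

/-- In a linear chart, the centre can be pushed to each nearby fixed point of the group. -/
theorem exists_isIsotopy_of_isLinear (O : Orbifold n X) {w : OrbifoldChart n X} (hw : w ∈ O.atlas)
    {ρ : w.Γ →* (EuclideanSpace ℝ (Fin n) →L[ℝ] EuclideanSpace ℝ (Fin n))} (hρ : w.IsLinear ρ) :
    ∃ ε > 0, ∀ v : w.domain, ‖(v : EuclideanSpace ℝ (Fin n))‖ < ε → (∀ γ, ρ γ v = v) →
      ∃ (f : X → X) (F : X × unitInterval → X), f (w.proj hρ.center) = w.proj v ∧
        IsIsotopy O O id f F ∧ ∃ K : Set X, IsCompact K ∧ isotopySupp F ⊆ K ∧ K ⊆ w.image := by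
  obtain ⟨χ, K, hχ, hK, hKB, hχK, hχ0, hχρ⟩ := exists_invariant_bump ρ
    (B := (w.domain : Set (EuclideanSpace ℝ (Fin n)))) (w.domain.2.mem_nhds hρ.zero_mem)
    fun γ v hv => by
      have := hρ.coe_smul γ ⟨v, hv⟩
      exact this ▸ (γ • (⟨v, hv⟩ : w.domain)).2
  obtain ⟨L, hL⟩ := hχ.lipschitzWith_of_hasCompactSupport (.intro hK hχK) (by simp)
  -- This bound forces `L * ‖v‖ < 1`; the `+ 1` covers `L = 0`.
  refine ⟨(L + 1 : ℝ)⁻¹, by positivity, fun v hv hfix => ?_⟩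
  have hLv : ∀ t : unitInterval, L * ‖(t : ℝ) • (v : EuclideanSpace ℝ (Fin n))‖ < 1 := by
    intro t
    have h1 : ‖(t : ℝ) • (v : EuclideanSpace ℝ (Fin n))‖ ≤ ‖(v : EuclideanSpace ℝ (Fin n))‖ := by
      rw [norm_smul, Real.norm_of_nonneg t.2.1]
      exact mul_le_of_le_one_left (norm_nonneg _) t.2.2
    have h2 : (L + 1 : ℝ) * ‖(v : EuclideanSpace ℝ (Fin n))‖ < 1 := by
      calc (L + 1 : ℝ) * ‖(v : EuclideanSpace ℝ (Fin n))‖ < (L + 1) * (L + 1 : ℝ)⁻¹ := by gcongr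
        _ = 1 := mul_inv_cancel₀ (by positivity)
    have h3 : (L : ℝ) * ‖(t : ℝ) • (v : EuclideanSpace ℝ (Fin n))‖
        ≤ L * ‖(v : EuclideanSpace ℝ (Fin n))‖ := by gcongr
    nlinarith [norm_nonneg (v : EuclideanSpace ℝ (Fin n))]
  choose h hh hhs using fun t => exists_homeomorph_add_smul hχ hL (hLv t)
  have hfixed : ∀ t, ∀ u ∉ K, h t u = u := fun t u hu => by
    rw [hh, hχK u hu, zero_smul, add_zero]
  -- If `h t u` left the domain it would lie outside `K` and be fixed by `h t`; injectivity would
  -- give `h t u = u`, a point of the domain.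
  have hmem : ∀ t (u : w.domain), h t u ∈ w.domain := by
    intro t u
    by_contra hu
    have h1 := hfixed t _ fun hK' => hu (hKB hK')
    rw [(h t).injective h1] at hu
    exact hu u.2
  have hmem' : ∀ t (u : w.domain), (h t).symm u ∈ w.domain := by
    intro t u
    by_contra hu
    have h1 := hfixed t _ fun hK' => hu (hKB hK')
    rw [(h t).apply_symm_apply] at h1
    exact hu (h1 ▸ u.2)
  let Ψ : unitInterval → w.domain → w.domain := fun t u => ⟨h t u, hmem t u⟩
  let Θ : unitInterval → w.domain → w.domain := fun t u => ⟨(h t).symm u, hmem' t u⟩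
  have hKw : IsCompact ((Subtype.val : w.domain → _) ⁻¹' K) :=
    (w.domain.isOpenEmbedding'.isInducing.isCompact_preimage_iff (by
      simpa using hKB)).2 hK
  have heq : ∀ t (γ : w.Γ) p, Ψ t (γ • p) = γ • Ψ t p := by
    intro t γ p
    apply Subtype.ext
    rw [hρ.coe_smul]
    change h t (γ • p : w.domain) = ρ γ (h t p)
    rw [hh, hh, hρ.coe_smul, hχρ, map_add, map_smul, map_smul, hfix]
  have hid : ∀ t, ∀ p ∉ (Subtype.val : w.domain → _) ⁻¹' K, Ψ t p = p := fun t p hp =>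
    Subtype.ext (hfixed t p hp)
  have hsm : ContMDiff (𝓘(ℝ, EuclideanSpace ℝ (Fin n)).prod (𝓡∂ 1))
      𝓘(ℝ, EuclideanSpace ℝ (Fin n)) ∞ fun q : w.domain × unitInterval => Ψ q.2 q.1 := by
    rw [← ContMDiff.subtypeVal_comp_iff]
    have e : (Subtype.val ∘ fun q : w.domain × unitInterval => Ψ q.2 q.1) = fun q =>
        (q.1 : EuclideanSpace ℝ (Fin n)) + χ q.1 • (q.2 : ℝ) • (v : EuclideanSpace ℝ (Fin n)) :=
      funext fun q => hh q.2 q.1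
    rw [e]
    have h1 : ContMDiff (𝓘(ℝ, EuclideanSpace ℝ (Fin n)).prod (𝓡∂ 1))
        𝓘(ℝ, EuclideanSpace ℝ (Fin n)) ∞ fun q : w.domain × unitInterval =>
          (q.1 : EuclideanSpace ℝ (Fin n)) := contMDiff_subtype_val.comp contMDiff_fst
    have h2 : ContMDiff (𝓘(ℝ, EuclideanSpace ℝ (Fin n)).prod (𝓡∂ 1))
        𝓘(ℝ, ℝ) ∞ fun q : w.domain × unitInterval => (q.2 : ℝ) :=
      contMDiff_subtypeVal_Icc.comp contMDiff_snd
    exact h1.add ((hχ.contMDiff.comp h1).smul (h2.smul contMDiff_const))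
  have hΘ : ∀ t, SmoothOpens (Θ t) := by
    intro t
    rw [SmoothOpens, ← ContMDiff.subtypeVal_comp_iff]
    exact (hhs t).contMDiff.comp contMDiff_subtype_val
  refine ⟨_, _, ?_, O.isIsotopy_descend hw hKw hsm heq hid hΘ
    (fun t p => Subtype.ext ((h t).symm_apply_apply _))
    (fun t p => Subtype.ext ((h t).apply_symm_apply _)) (fun p => Subtype.ext ?_), _,
    hKw.image w.continuous_proj, O.isotopySupp_descend_subset hKw heq hid, image_subset_range _ _⟩
  · rw [descend_proj (heq 1)]
    congr 1
    apply Subtype.ext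
    change h 1 (0 : EuclideanSpace ℝ (Fin n)) = v
    rw [hh, hχ0]
    simp
  · change h 0 p = p
    rw [hh]
    simp

end Orbifold

theorem proposition3p1 {n : ℕ} {X : Type*} [TopologicalSpace X] (O : Orbifold n X)
    (x : X) (U : Set X) (hU : IsOpen U) (hx : x ∈ U) :
    ∃ V : Set X, (∃ W : Set X, IsOpen W ∧ V = W ∩ O.stratumComponent x) ∧ x ∈ V ∧ V ⊆ U ∧
      ∀ y ∈ V, ∃ f ∈ O.diffC, f x = y ∧
        ∃ F : X × unitInterval → X, Orbifold.IsIsotopy O O id f F ∧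
          IsCompact (Orbifold.isotopySupp F) ∧ Orbifold.isotopySupp F ⊆ U := by
  obtain ⟨w, hw, ρ, hρ, hwx, hwU⟩ := O.exists_isLinear_mem_atlas x (hU.mem_nhds hx)
  obtain ⟨ε, hε, hpush⟩ := O.exists_isIsotopy_of_isLinear hw hρ
  let N : Set w.domain := {v | ‖(v : EuclideanSpace ℝ (Fin n))‖ < ε}
  have hN : IsOpen N := isOpen_lt (by fun_prop) continuous_const
  have hxN : x ∈ w.proj '' N := ⟨hρ.center, by
    simpa [N, OrbifoldChart.IsLinear.center] using hε, hwx⟩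
  refine ⟨_, ⟨w.proj '' N, w.isOpenMap_proj N hN, rfl⟩, ⟨hxN, mem_connectedComponentIn rfl⟩,
    inter_subset_left.trans ((image_subset_range _ _).trans hwU), ?_⟩
  rintro _ ⟨⟨v, hv, rfl⟩, hy⟩
  -- The component `Σ(x)` enters only through its inclusion in the stratum.
  have hs : O.sdim (w.proj v) = O.sdim (w.proj hρ.center) := by
    rw [hwx]
    exact connectedComponentIn_subset (O.stratum (O.sdim x)) x hy
  obtain ⟨f, F, hf, hF, K, hK, hFK, hKw⟩ := hpush v hv fun γ =>
    O.rep_apply_eq_of_sdim_eq hw hρ hs γ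
  rw [hwx] at hf
  have hcomp : IsCompact (Orbifold.isotopySupp F) := hK.of_isClosed_subset isClosed_closure hFK
  have hfF : f = fun z => F (z, 1) := funext fun z => (hF.2.2.2 z).symm
  refine ⟨f, ⟨hfF ▸ hF.2.1 1, ?_, F, hF, hcomp⟩, hf, F, hF, hcomp,
    hFK.trans (hKw.trans hwU)⟩
  -- A point moved by `f` is moved by the isotopy at time `1`.
  refine hcomp.of_isClosed_subset isClosed_closure (closure_mono fun z hz => ⟨1, ?_⟩)
  rwa [hF.2.2.2]
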